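/- All graphs are finite directed graphs $G=(V,E)$. Vertices $u,v$ are in the same strongly connected component (SCC) if each can be reached from the other; $SCCs(G)$ is the set of all SCCs. The diameter $D(G)$ is the largest finite distance between two vertices, i.e. the largest length of a shortest directed walk from $u$ to $v$, over all pairs with $v$ reachable from $u$. A (deterministic) symbolic algorithm knows the vertex set $V$ and accesses the edges only through one-step operations $\mathrm{Pre}(S)=\{v\in V\mid \exists s\in S: (v,s)\in E\}$ and $\mathrm{Post}(S)=\{v\in V\mid \exists s\in S: (s,v)\in E\}$ for sets $S\subseteq V$ of its choice; its choices and its output may depend arbitrarily on the sets returned so far, and only one-step operations are counted (basic set operations, storage and all other computation are free). A randomized symbolic algorithm is a probability distribution on deterministic ones; it has error at most $\varepsilon$ on a class of graphs if on each graph of the class its output differs from $SCCs(G)$ with probability at most $\varepsilon$. **Theorem 3.1.** Any deterministic or bounded-error randomized symbolic algorithm that computes the SCCs of graphs with $n$ vertices needs $\Omega(n)$ one-step operations, even on graphs of constant diameter; it also needs $\Omega(|SCCs(G)|\cdot D(G))$ one-step operations. Precisely: 1. There is a constant $c>0$ such that for all integers $d\ge 1$ and $n\ge d+1$, and every deterministic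 symbolic algorithm that outputs $SCCs(G)$ for every graph $G$ on $\{0,\dots,n-1\}$ with $D(G)\le d$, there is a graph $G$ on $\{0,\dots,n-1\}$ with $D(G)=d$ on which the algorithm performs at least $c\,n$ one-step operations. 2. There is a constant $c>0$ such that for all integers $s,d\ge 1$ and $n\ge s(d+1)$, and every deterministic symbolic algorithm that outputs $SCCs(G)$ for every graph $G$ on $\{0,\dots,n-1\}$ with $D(G)\le d$, there is a graph $G$ on $\{0,\dots,n-1\}$ with $|SCCs(G)|=s$ and $D(G)=d$ on which the algorithm performs at least $c\cdot|SCCs(G)|\cdot D(G)$ one-step operations. 3. For every $\varepsilon\in[0,1/2)$, statements 1 and 2 also hold, with a constant $c>0$ that depends only on $\varepsilon$, for randomized symbolic algorithms with error at most $\varepsilon$ on the graphs $G$ on $\{0,\dots,n-1\}$ with $D(G)\le d$, where the number of one-step operations is replaced by its expectation. -/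

import Mathlib

open scoped ENNReal

namespace SymbolicGraph

variable {V : Type*}

/-- `Pre(S) = {v ∈ V ∣ ∃ s ∈ S, (v, s) ∈ E}`. -/
def Pre (G : Digraph V) (S : Set V) : Set V := {v | ∃ s ∈ S, G.Adj v s}

/-- `Post(S) = {v ∈ V ∣ ∃ s ∈ S, (s, v) ∈ E}`. -/
def Post (G : Digraph V) (S : Set V) : Set V := {v | ∃ s ∈ S, G.Adj s v}

/-- `HasWalk G k u v`: there is a directed walk with exactly `k` edges from `u` to `v`. -/
def HasWalk (G : Digraph V) : ℕ → V → V → Prop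
  | 0, u, v => u = v
  | k + 1, u, v => ∃ w, G.Adj u w ∧ HasWalk G k w v

/-- `v` can be reached from `u` by a directed walk (possibly of length `0`). -/
def Reaches (G : Digraph V) (u v : V) : Prop := ∃ k, HasWalk G k u v

/-- The strongly connected component of `u`: all vertices that reach `u` and are reached from it. -/
def scc (G : Digraph V) (u : V) : Set V := {v | Reaches G u v ∧ Reaches G v u}

/-- The set `SCCs(G)` of all strongly connected components. -/
def SCCs (G : Digraph V) : Set (Set V) := Set.range (scc G)

/-- The length of a shortest directed walk from `u` to `v`; only used when `v` is reachable
from `u`. -/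
noncomputable def dist (G : Digraph V) (u v : V) : ℕ := sInf {k | HasWalk G k u v}

/-- The set of all finite distances between vertices of the graph. -/
def finiteDistances (G : Digraph V) : Set ℕ := {k | ∃ u v, Reaches G u v ∧ dist G u v = k}

/-- On a finite graph the supremum in `diam` is over a finite set. -/
theorem finite_finiteDistances [Finite V] (G : Digraph V) : (finiteDistances G).Finite :=
  (Set.finite_range (fun p : V × V => dist G p.1 p.2)).subset (by
    rintro k ⟨u, v, -, h⟩
    exact ⟨(u, v), h⟩)

/-- The diameter of a (finite) graph: its largest finite distance. -/
noncomputable def diam (G : Digraph V) : ℕ := sSup (finiteDistances G)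

/-- A deterministic symbolic algorithm, for an input graph with the known vertex set `V` and unknown
edges, whose result is a family of vertex sets. The graph is accessed only through one-step
operations. The algorithm either halts with a result, or applies `Pre` or `Post` to a vertex set of
its choice and continues in a way that depends on the returned set. Everything that happens between
two one-step operations (basic set operations on any number of stored sets, and all computations of
an ordinary random access machine) is free and unrestricted: the next set `S`, the next operation
and the result are arbitrary functions of all the sets returned so far. -/
inductive Algorithm (V : Type*) : Type _
  | halt (result : Set (Set V)) : Algorithm V
  | pre (S : Set V) (next : Set V → Algorithm V) : Algorithm V
  | post (S : Set V) (next : Set V → Algorithm V) : Algorithm V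

/-- The result of running an algorithm on the graph `G`. -/
def Algorithm.result (G : Digraph V) : Algorithm V → Set (Set V)
  | .halt r => r
  | .pre S next => (next (Pre G S)).result G
  | .post S next => (next (Post G S)).result G

/-- The number of one-step operations that an algorithm performs on the graph `G`. -/
def Algorithm.steps (G : Digraph V) : Algorithm V → ℕ
  | .halt _ => 0
  | .pre S next => (next (Pre G S)).steps G + 1
  | .post S next => (next (Post G S)).steps G + 1

/-- The deterministic algorithm `A` computes the SCCs of every graph in the class `C`. -/
def ComputesSCCs (A : Algorithm V) (C : Set (Digraph V)) : Prop :=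
  ∀ G ∈ C, A.result G = SCCs G

/-- A randomized symbolic algorithm: fixing all coin tosses in advance gives a deterministic one,
so this is a probability distribution on deterministic algorithms. (For finite `V` there are only
countably many of these, so that `PMF` covers all probability distributions.) -/
abbrev RandAlgorithm (V : Type*) := PMF (Algorithm V)

/-- On every graph in the class `C`, the randomized algorithm `R` outputs something different from
the set of SCCs with probability at most `ε`. -/
def ComputesSCCsWithError (R : RandAlgorithm V) (ε : ℝ) (C : Set (Digraph V)) : Prop :=
  ∀ G ∈ C, R.toOuterMeasure {A | A.result G ≠ SCCs G} ≤ ENNReal.ofReal ε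

/-- The expected number of one-step operations that `R` performs on the graph `G`. -/
noncomputable def expectedSteps (R : RandAlgorithm V) (G : Digraph V) : ℝ≥0∞ :=
  ∑' A, R A * (A.steps G : ℝ≥0∞)

/-- The graphs of diameter at most `d`. -/
def diamAtMost (V : Type*) (d : ℕ) : Set (Digraph V) := {G | diam G ≤ d}

end SymbolicGraph

/-! This is a sensitivity argument. In `ladder ℓ B`, all edges within a level and upwards are
present, and the bit `j ∈ B` decides whether level `j + 1` has edges down to level `j`. `Pre S`
reveals only the bit at the highest level of `S`, and `Post S` only the bit below its lowest level:
the upward edges make everything else predictable. So each one-step operation reads at most one bit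
(`Algorithm.exists_certificate`).

Flipping a bit between occupied levels merges or splits SCCs (`SCCs_ladder_ne`). If the flipped
graph still has diameter at most `d`, a correct algorithm must read that bit, and one with error `ε`
must do so with probability at least `1 - 2 * ε`. Summing over such bits bounds the expected cost
(`le_expectedSteps_ladder`). It remains to choose `B` with many flippable bits. Deterministic
algorithms are the case of a point mass and `ε = 0`. -/

namespace SymbolicGraph

/-! ### Walks, reachability and distance -/

section Walks

variable {V : Type*}

theorem HasWalk.trans {G : Digraph V} {k l : ℕ} {u v w : V} (h : HasWalk G k u v)
    (h' : HasWalk G l v w) : HasWalk G (k + l) u w := by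
  induction k generalizing u with
  | zero =>
    obtain rfl : u = v := h
    simpa using h'
  | succ k ih =>
    obtain ⟨x, hx, hw⟩ := h
    rw [Nat.add_right_comm]
    exact ⟨x, hx, ih hw⟩

theorem Reaches.trans {G : Digraph V} {u v w : V} (h : Reaches G u v) (h' : Reaches G v w) :
    Reaches G u w := by
  obtain ⟨k, hk⟩ := h
  obtain ⟨l, hl⟩ := h'
  exact ⟨k + l, hk.trans hl⟩

theorem Reaches.refl (G : Digraph V) (u : V) : Reaches G u u := ⟨0, rfl⟩

theorem Reaches.of_adj {G : Digraph V} {u v : V} (h : G.Adj u v) : Reaches G u v :=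
  ⟨1, v, h, rfl⟩

theorem SCCs_ne_of_reaches {G G' : Digraph V} {u w : V} (h₁ : Reaches G u w)
    (h₂ : Reaches G w u) (h₃ : ¬ Reaches G' w u) : SCCs G ≠ SCCs G' := by
  intro h
  have hm : scc G u ∈ SCCs G' := h ▸ Set.mem_range_self u
  obtain ⟨x, hx⟩ := hm
  have hu : u ∈ scc G' x := hx ▸ ⟨Reaches.refl G u, Reaches.refl G u⟩
  have hw : w ∈ scc G' x := hx ▸ ⟨h₁, h₂⟩
  exact h₃ (hw.2.trans hu.1)

theorem dist_le_of_hasWalk {G : Digraph V} {k : ℕ} {u v : V} (h : HasWalk G k u v) :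
    dist G u v ≤ k :=
  Nat.sInf_le h

theorem le_diam [Finite V] {G : Digraph V} {u v : V} (h : Reaches G u v) :
    dist G u v ≤ diam G :=
  le_csSup (finite_finiteDistances G).bddAbove ⟨u, v, h, rfl⟩

end Walks

/-! ### Ladder graphs: one bit per operation -/

section Ladder

variable {V : Type*}

/-- The graph on vertices with levels `ℓ` that has all edges within a level and to higher levels,
and in which all edges from level `j + 1` to level `j` are present exactly if `j ∈ B`. -/
def ladder (ℓ : V → ℕ) (B : Set ℕ) : Digraph V where
  Adj u v := ℓ u ≤ ℓ v ∨ (ℓ u = ℓ v + 1 ∧ ℓ v ∈ B)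

variable {ℓ : V → ℕ} {B : Set ℕ}

/-- A downward edge into a non-maximal level of `S` starts no higher than some `t ∈ S`, so its
source already has an unconditional edge to `t`. -/
theorem Pre_ladder_subset {B' : Set ℕ} {S : Set V} {q : ℕ}
    (hmax : ∀ s ∈ S, ℓ s = q ∨ ∃ t ∈ S, ℓ s < ℓ t) (hq : q ∈ B ↔ q ∈ B') :
    Pre (ladder ℓ B) S ⊆ Pre (ladder ℓ B') S := by
  rintro v ⟨s, hs, h | ⟨h, hB⟩⟩
  · exact ⟨s, hs, Or.inl h⟩
  · rcases hmax s hs with rfl | ⟨t, ht, hst⟩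
    · exact ⟨s, hs, Or.inr ⟨h, hq.1 hB⟩⟩
    · exact ⟨t, ht, Or.inl (by omega)⟩

theorem Post_ladder_subset {B' : Set ℕ} {S : Set V} {q : ℕ}
    (hmin : ∀ s ∈ S, ℓ s - 1 = q ∨ ∃ t ∈ S, ℓ t < ℓ s) (hq : q ∈ B ↔ q ∈ B') :
    Post (ladder ℓ B) S ⊆ Post (ladder ℓ B') S := by
  rintro v ⟨s, hs, h | ⟨h, hB⟩⟩
  · exact ⟨s, hs, Or.inl h⟩
  · rcases hmin s hs with hsq | ⟨t, ht, hst⟩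
    · obtain rfl : ℓ v = q := by omega
      exact ⟨s, hs, Or.inr ⟨h, hq.1 hB⟩⟩
    · exact ⟨t, ht, Or.inl (by omega)⟩

/-- A `Pre` operation depends on a single bit of `B`. -/
theorem exists_Pre_ladder_eq [Finite V] (ℓ : V → ℕ) (S : Set V) :
    ∃ q, ∀ B B' : Set ℕ, (q ∈ B ↔ q ∈ B') → Pre (ladder ℓ B) S = Pre (ladder ℓ B') S := by
  obtain ⟨q, hq⟩ : ∃ q, ∀ s ∈ S, ℓ s = q ∨ ∃ t ∈ S, ℓ s < ℓ t := by
    rcases S.eq_empty_or_nonempty with rfl | hS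
    · simp
    · obtain ⟨t, ht, hmax⟩ := Set.exists_max_image S ℓ S.toFinite hS
      exact ⟨ℓ t, fun s hs => (hmax s hs).eq_or_lt.imp id fun h => ⟨t, ht, h⟩⟩
  exact ⟨q, fun B B' h =>
    (Pre_ladder_subset hq h).antisymm (Pre_ladder_subset hq h.symm)⟩

/-- A `Post` operation depends on a single bit of `B`. -/
theorem exists_Post_ladder_eq [Finite V] (ℓ : V → ℕ) (S : Set V) :
    ∃ q, ∀ B B' : Set ℕ, (q ∈ B ↔ q ∈ B') → Post (ladder ℓ B) S = Post (ladder ℓ B') S := by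
  obtain ⟨q, hq⟩ : ∃ q, ∀ s ∈ S, ℓ s - 1 = q ∨ ∃ t ∈ S, ℓ t < ℓ s := by
    rcases S.eq_empty_or_nonempty with rfl | hS
    · simp
    · obtain ⟨t, ht, hmin⟩ := Set.exists_min_image S ℓ S.toFinite hS
      -- If `ℓ t = 0`, the truncated value `0` is harmless: there is no level below to descend to.
      refine ⟨ℓ t - 1, fun s hs => ?_⟩
      rcases (hmin s hs).eq_or_lt with h | h
      · exact Or.inl (by rw [h])
      · exact Or.inr ⟨t, ht, h⟩
  exact ⟨q, fun B B' h =>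
    (Post_ladder_subset hq h).antisymm (Post_ladder_subset hq h.symm)⟩

/-- On a ladder, the result of an algorithm depends on at most one bit per one-step operation. -/
theorem Algorithm.exists_certificate [Finite V] (ℓ : V → ℕ) (B : Set ℕ) (A : Algorithm V) :
    ∃ Q : Finset ℕ, Q.card ≤ A.steps (ladder ℓ B) ∧ ∀ B' : Set ℕ, (∀ q ∈ Q, q ∈ B ↔ q ∈ B') →
      A.result (ladder ℓ B') = A.result (ladder ℓ B) := by
  induction A with
  | halt r => exact ⟨∅, by simp, fun _ _ => rfl⟩
  | pre S next ih =>
    obtain ⟨q, hq⟩ := exists_Pre_ladder_eq ℓ S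
    obtain ⟨Q, hQ, hres⟩ := ih (Pre (ladder ℓ B) S)
    refine ⟨insert q Q, (Finset.card_insert_le _ _).trans (Nat.succ_le_succ hQ), fun B' h => ?_⟩
    simp only [Algorithm.result]
    -- Equal answers on both ladders lead to the same continuation.
    rw [← hq B B' (h q (Finset.mem_insert_self q Q))]
    exact hres B' fun x hx => h x (Finset.mem_insert_of_mem hx)
  | post S next ih =>
    obtain ⟨q, hq⟩ := exists_Post_ladder_eq ℓ S
    obtain ⟨Q, hQ, hres⟩ := ih (Post (ladder ℓ B) S)
    refine ⟨insert q Q, (Finset.card_insert_le _ _).trans (Nat.succ_le_succ hQ), fun B' h => ?_⟩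
    simp only [Algorithm.result]
    rw [← hq B B' (h q (Finset.mem_insert_self q Q))]
    exact hres B' fun x hx => h x (Finset.mem_insert_of_mem hx)

/-- An edge descends at most one level and only through a set bit, so upward detours cannot bypass
an unset bit. -/
theorem HasWalk.ladder_le {k : ℕ} {u v : V} (h : HasWalk (ladder ℓ B) k u v) :
    ℓ u ≤ ℓ v + k ∧ ∀ i, ℓ v ≤ i → i < ℓ u → i ∈ B := by
  induction k generalizing u with
  | zero =>
    obtain rfl : u = v := h
    exact ⟨le_rfl, fun i _ _ => by omega⟩
  | succ k ih =>
    obtain ⟨w, hw, hk⟩ := h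
    obtain ⟨h₁, h₂⟩ := ih hk
    rcases hw with hw | ⟨hw, hB⟩
    · exact ⟨by omega, fun i hi hi' => h₂ i hi (by omega)⟩
    · refine ⟨by omega, fun i hi hi' => ?_⟩
      rcases (show i ≤ ℓ w by omega).eq_or_lt with rfl | hlt
      · exact hB
      · exact h₂ i hi hlt

theorem hasWalk_ladder (hℓ : ∀ u, ∀ i < ℓ u, ∃ w, ℓ w = i) {k : ℕ} {u v : V}
    (hk : ℓ u = ℓ v + k + 1) (h : ∀ i, ℓ v ≤ i → i < ℓ u → i ∈ B) :
    HasWalk (ladder ℓ B) (k + 1) u v := by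
  induction k generalizing u with
  | zero => exact ⟨v, Or.inr ⟨hk, h _ le_rfl (by omega)⟩, rfl⟩
  | succ k ih =>
    obtain ⟨w, hw⟩ := hℓ u (ℓ v + k + 1) (by omega)
    exact ⟨w, Or.inr ⟨by omega, h _ (by omega) (by omega)⟩,
      ih hw fun i hi hi' => h i hi (by omega)⟩

theorem reaches_ladder_iff (hℓ : ∀ u, ∀ i < ℓ u, ∃ w, ℓ w = i) {u v : V} :
    Reaches (ladder ℓ B) u v ↔ ∀ i, ℓ v ≤ i → i < ℓ u → i ∈ B := by
  refine ⟨fun ⟨k, hk⟩ => hk.ladder_le.2, fun h => ?_⟩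
  rcases le_or_gt (ℓ u) (ℓ v) with huv | huv
  · exact Reaches.of_adj (Or.inl huv)
  · exact ⟨_, hasWalk_ladder hℓ (k := ℓ u - ℓ v - 1) (by omega) h⟩

/-- If at most `d` consecutive bits are set, then the diameter is at most `d`. -/
theorem diam_ladder_le (hℓ : ∀ u, ∀ i < ℓ u, ∃ w, ℓ w = i) {d : ℕ} (hd : 1 ≤ d)
    (hB : ∀ a, ∃ i, a ≤ i ∧ i ≤ a + d ∧ i ∉ B) : diam (ladder ℓ B) ≤ d := by
  refine csSup_le' ?_
  rintro k ⟨u, v, h, rfl⟩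
  rcases le_or_gt (ℓ u) (ℓ v) with huv | huv
  · exact (dist_le_of_hasWalk (k := 1) ⟨v, Or.inl huv, rfl⟩).trans hd
  · rw [reaches_ladder_iff hℓ] at h
    refine (dist_le_of_hasWalk
      (hasWalk_ladder hℓ (k := ℓ u - ℓ v - 1) (by omega) h)).trans ?_
    obtain ⟨i, hi, hi', hiB⟩ := hB (ℓ v)
    -- A descent of more than `d` levels would need the unset bit `i`.
    by_contra hlt
    exact hiB (h i hi (by omega))

theorem diam_ladder_eq [Finite V] (hℓ : ∀ u, ∀ i < ℓ u, ∃ w, ℓ w = i) {d : ℕ} (hd : 1 ≤ d)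
    (hB : ∀ a, ∃ i, a ≤ i ∧ i ≤ a + d ∧ i ∉ B) (hB' : ∀ i < d, i ∈ B) {u : V} (hu : ℓ u = d) :
    diam (ladder ℓ B) = d := by
  refine (diam_ladder_le hℓ hd hB).antisymm ?_
  obtain ⟨v, hv⟩ := hℓ u 0 (by omega)
  have hr : Reaches (ladder ℓ B) u v :=
    (reaches_ladder_iff hℓ).2 fun i _ hi => hB' i (by omega)
  have hw : HasWalk (ladder ℓ B) (dist (ladder ℓ B) u v) u v := Nat.sInf_mem hr
  have := hw.ladder_le.1
  exact le_trans (by omega) (le_diam hr)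

theorem SCCs_ladder_ne (hℓ : ∀ u, ∀ i < ℓ u, ∃ w, ℓ w = i) {B' : Set ℕ} {w : V} {j : ℕ}
    (hw : ℓ w = j + 1) (hj : ¬ (j ∈ B ↔ j ∈ B')) :
    SCCs (ladder ℓ B) ≠ SCCs (ladder ℓ B') := by
  obtain ⟨u, hu⟩ := hℓ w j (by omega)
  have key : ∀ B : Set ℕ, Reaches (ladder ℓ B) w u ↔ j ∈ B := fun B => by
    rw [reaches_ladder_iff hℓ, hu, hw]
    exact ⟨fun h => h j le_rfl (Nat.lt_succ_self j), fun h i hi hi' => by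
      obtain rfl : i = j := by omega
      exact h⟩
  have hup : ∀ B : Set ℕ, Reaches (ladder ℓ B) u w := fun B =>
    Reaches.of_adj (Or.inl (by omega))
  by_cases hjB : j ∈ B
  · exact SCCs_ne_of_reaches (hup B) ((key B).2 hjB) (mt (key B').1 (by tauto))
  · exact (SCCs_ne_of_reaches (hup B') ((key B').2 (by tauto)) (mt (key B).1 hjB)).symm

end Ladder

/-! ### Error probability and expected number of bits read -/

section Randomized

variable {V : Type*}

/-- An algorithm with equal outputs on both graphs errs on at least one of them; apply the union
bound. -/
theorem one_sub_two_mul_le_prob_result_ne {R : RandAlgorithm V} {ε : ℝ} (hε : 0 ≤ ε)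
    {C : Set (Digraph V)} (hR : ComputesSCCsWithError R ε C) {G G' : Digraph V} (hG : G ∈ C)
    (hG' : G' ∈ C) (hne : SCCs G ≠ SCCs G') :
    ENNReal.ofReal (1 - 2 * ε) ≤ R.toOuterMeasure {A | A.result G' ≠ A.result G} := by
  have hcover : (Set.univ : Set (Algorithm V)) ⊆ {A | A.result G' ≠ A.result G} ∪
      ({A | A.result G ≠ SCCs G} ∪ {A | A.result G' ≠ SCCs G'}) := by
    intro A _
    by_contra h
    simp only [Set.mem_union, Set.mem_ofPred_eq, not_or, not_not] at h
    exact hne (by rw [← h.2.1, ← h.2.2, h.1])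
  have huniv : R.toOuterMeasure Set.univ = 1 :=
    (PMF.toOuterMeasure_apply_eq_one_iff R _).2 (Set.subset_univ _)
  have h1 : 1 ≤ R.toOuterMeasure {A | A.result G' ≠ A.result G} +
      (ENNReal.ofReal ε + ENNReal.ofReal ε) := by
    rw [← huniv]
    refine (MeasureTheory.measure_mono hcover).trans
      ((MeasureTheory.measure_union_le _ _).trans ?_)
    gcongr
    exact (MeasureTheory.measure_union_le _ _).trans (add_le_add (hR G hG) (hR G' hG'))
  rw [← ENNReal.ofReal_add hε hε, ← two_mul] at h1
  rw [ENNReal.ofReal_sub _ (by positivity), ENNReal.ofReal_one]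
  exact tsub_le_iff_right.2 h1

theorem not_mem_iff_mem_symmDiff_singleton {α : Type*} (B : Set α) (j : α) :
    ¬ (j ∈ B ↔ j ∈ symmDiff B {j}) := by
  simp only [Set.mem_symmDiff, Set.mem_singleton_iff]
  tauto

/-- If the SCCs of a ladder change with each of the bits in `J`, then all these bits have to
be read with probability at least `1 - 2 * ε`. -/
theorem le_expectedSteps_ladder [Finite V] {ℓ : V → ℕ} {B : Set ℕ} {R : RandAlgorithm V} {ε : ℝ}
    (hε : 0 ≤ ε) {C : Set (Digraph V)} (hR : ComputesSCCsWithError R ε C)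
    (hB : ladder ℓ B ∈ C) (J : Finset ℕ)
    (hJ : ∀ j ∈ J, ladder ℓ (symmDiff B {j}) ∈ C ∧
      SCCs (ladder ℓ B) ≠ SCCs (ladder ℓ (symmDiff B {j}))) :
    ENNReal.ofReal ((1 - 2 * ε) * J.card) ≤ expectedSteps R (ladder ℓ B) := by
  classical
  let E : ℕ → Set (Algorithm V) := fun j =>
    {A | A.result (ladder ℓ (symmDiff B {j})) ≠ A.result (ladder ℓ B)}
  calc ENNReal.ofReal ((1 - 2 * ε) * J.card)
      = ∑ _j ∈ J, ENNReal.ofReal (1 - 2 * ε) := by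
        rw [Finset.sum_const, nsmul_eq_mul, mul_comm,
          ENNReal.ofReal_mul (Nat.cast_nonneg _), ENNReal.ofReal_natCast]
    _ ≤ ∑ j ∈ J, R.toOuterMeasure (E j) := Finset.sum_le_sum fun j hj =>
        one_sub_two_mul_le_prob_result_ne hε hR hB (hJ j hj).1 (hJ j hj).2
    _ = ∑' A, ∑ j ∈ J, (E j).indicator R A := by
        simp only [PMF.toOuterMeasure_apply]
        exact (Summable.tsum_finsetSum fun _ _ => ENNReal.summable).symm
    _ ≤ expectedSteps R (ladder ℓ B) := by
        refine ENNReal.tsum_le_tsum fun A => ?_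
        obtain ⟨Q, hQ, hres⟩ := A.exists_certificate ℓ B
        -- Flipping a bit outside the certificate leaves the output unchanged.
        have hsub : J.filter (fun j => A ∈ E j) ⊆ Q := by
          intro j hj
          by_contra hjQ
          refine (Finset.mem_filter.1 hj).2 (hres _ fun q hq => ?_)
          have : q ≠ j := fun h => hjQ (h ▸ hq)
          simp [Set.mem_symmDiff, this]
        simp only [Set.indicator_apply]
        rw [← Finset.sum_filter, Finset.sum_const, nsmul_eq_mul, mul_comm]
        gcongr
        exact (Finset.card_le_card hsub).trans hQ

theorem computesSCCsWithError_pure {A : Algorithm V} {C : Set (Digraph V)}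
    (hA : ComputesSCCs A C) : ComputesSCCsWithError (PMF.pure A) 0 C := by
  classical
  intro G hG
  rw [PMF.toOuterMeasure_pure_apply, if_neg (by simpa using hA G hG)]
  exact zero_le

theorem expectedSteps_pure (A : Algorithm V) (G : Digraph V) :
    expectedSteps (PMF.pure A) G = A.steps G := by
  classical
  rw [expectedSteps, tsum_eq_single A fun A' h => by simp [PMF.pure_apply, h]]
  simp [PMF.pure_apply]

theorem le_steps_of_ofReal_le_expectedSteps_pure {A : Algorithm V} {G : Digraph V} {x : ℝ}
    (h : ENNReal.ofReal x ≤ expectedSteps (PMF.pure A) G) : x ≤ A.steps G := by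
  rw [expectedSteps_pure, ← ENNReal.ofReal_natCast] at h
  exact (ENNReal.ofReal_le_ofReal_iff (Nat.cast_nonneg _)).1 h

end Randomized

/-! ### The two hard families -/

section Instances

/-- The levels `0, …, m` on the vertices `0, …, n - 1`; the top level takes the surplus. -/
def level (n m : ℕ) (i : Fin n) : ℕ := min i m

theorem exists_level_eq {n m i : ℕ} (hm : m < n) (hi : i ≤ m) : ∃ w, level n m w = i :=
  ⟨⟨i, by omega⟩, min_eq_left hi⟩

theorem exists_level_eq_of_lt {n m : ℕ} (hm : m < n) :
    ∀ u, ∀ i < level n m u, ∃ w, level n m w = i := fun _ _ hi =>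
  exists_level_eq hm (hi.le.trans (min_le_right _ _))

/-- Flipping `j < d` splits the run of set bits, and flipping `j > d` adds an isolated one. Only `j
= d` would lengthen the run to `d + 1`. -/
theorem exists_notMem_Iio_symmDiff {d j : ℕ} (hd : 1 ≤ d) (hj : j ≠ d) (a : ℕ) :
    ∃ i, a ≤ i ∧ i ≤ a + d ∧ i ∉ symmDiff (Set.Iio d) {j} := by
  simp only [Set.mem_symmDiff, Set.mem_Iio, Set.mem_singleton_iff]
  by_cases h : a + d = j
  · exact ⟨a + d - 1, by omega, by omega, by omega⟩
  · exact ⟨a + d, by omega, le_rfl, by omega⟩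

theorem exists_diam_eq_and_card_le_expectedSteps {ε : ℝ} (hε : 0 ≤ ε) (hε' : ε < 1 / 2)
    {d n : ℕ} (hd : 1 ≤ d) (hn : d + 1 ≤ n) : ∃ G : Digraph (Fin n), diam G = d ∧
      ∀ R : RandAlgorithm (Fin n), ComputesSCCsWithError R ε (diamAtMost (Fin n) d) →
        ENNReal.ofReal ((1 - 2 * ε) / 3 * n) ≤ expectedSteps R G := by
  have hm : n - 1 < n := by omega
  have hℓ := exists_level_eq_of_lt hm
  obtain ⟨u, hu⟩ := exists_level_eq hm (show d ≤ n - 1 by omega)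
  have hdiam : diam (ladder (level n (n - 1)) (Set.Iio d)) = d :=
    diam_ladder_eq hℓ hd (fun a => ⟨a + d, by omega, le_rfl, by simp⟩) (fun i hi => hi) hu
  refine ⟨_, hdiam, fun R hR => ?_⟩
  have hJ := le_expectedSteps_ladder hε hR hdiam.le ((Finset.range (n - 1)).erase d) fun j hj => by
    rw [Finset.mem_erase, Finset.mem_range] at hj
    obtain ⟨w, hw⟩ := exists_level_eq hm (show j + 1 ≤ n - 1 by omega)
    exact ⟨diam_ladder_le hℓ hd (exists_notMem_Iio_symmDiff hd hj.1),
      SCCs_ladder_ne hℓ hw (not_mem_iff_mem_symmDiff_singleton _ j)⟩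
  refine le_trans (ENNReal.ofReal_le_ofReal ?_) hJ
  -- At least `n - 2` bits remain; if `n = 2`, then `d = 1` is out of range and one bit remains. The
  -- factor `3` is needed at `n = 3`, `d = 1`.
  have hcard : n ≤ 3 * ((Finset.range (n - 1)).erase d).card := by
    rw [Finset.card_erase_eq_ite, Finset.card_range]
    split_ifs with h
    · rw [Finset.mem_range] at h
      omega
    · omega
  have hcard' : (n : ℝ) ≤ 3 * ((Finset.range (n - 1)).erase d).card := by exact_mod_cast hcard
  nlinarith

/-- The bits that are not at the end of a block of `d + 1` consecutive levels. -/
def blockBits (d : ℕ) : Set ℕ := {j | ¬ (d + 1) ∣ (j + 1)}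

theorem exists_notMem_blockBits (d a : ℕ) : ∃ i, a ≤ i ∧ i ≤ a + d ∧ i ∉ blockBits d := by
  have h₁ := Nat.div_add_mod a (d + 1)
  have h₂ := Nat.mod_lt a (Nat.add_one_pos d)
  -- The last level of the block containing `a`.
  refine ⟨(d + 1) * (a / (d + 1)) + d, by omega, by omega, ?_⟩
  simp [blockBits, add_assoc]

theorem forall_mem_blockBits_iff {d a b : ℕ} (hab : a ≤ b) :
    (∀ i, a ≤ i → i < b → i ∈ blockBits d) ↔ a / (d + 1) = b / (d + 1) := by
  constructor
  · intro h
    by_contra hne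
    have hlt : a / (d + 1) < b / (d + 1) := (Nat.div_le_div_right hab).lt_of_ne hne
    have h₁ := (Nat.div_lt_iff_lt_mul (Nat.add_one_pos d)).1 hlt
    have h₂ := Nat.div_mul_le_self b (d + 1)
    refine h (b / (d + 1) * (d + 1) - 1) (by omega) (by omega) ?_
    rw [Nat.sub_add_cancel (by omega)]
    exact Dvd.intro_left _ rfl
  · rintro h i hi hib ⟨t, ht⟩
    have h₁ : a / (d + 1) < t := by
      rw [Nat.div_lt_iff_lt_mul (Nat.add_one_pos d), mul_comm]
      omega
    have h₂ : t ≤ b / (d + 1) := by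
      rw [Nat.le_div_iff_mul_le (Nat.add_one_pos d), mul_comm]
      omega
    omega

theorem scc_ladder_blockBits {V : Type*} {ℓ : V → ℕ} (hℓ : ∀ u, ∀ i < ℓ u, ∃ w, ℓ w = i)
    (d : ℕ) (u : V) :
    scc (ladder ℓ (blockBits d)) u = {v | ℓ v / (d + 1) = ℓ u / (d + 1)} := by
  ext v
  change Reaches _ _ _ ∧ Reaches _ _ _ ↔ ℓ v / (d + 1) = ℓ u / (d + 1)
  rw [reaches_ladder_iff hℓ, reaches_ladder_iff hℓ]
  rcases le_total (ℓ u) (ℓ v) with h | h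
  · rw [forall_mem_blockBits_iff h, eq_comm, and_iff_right]
    intro i _ _
    omega
  · rw [forall_mem_blockBits_iff h, and_iff_left]
    intro i _ _
    omega

theorem ncard_SCCs_ladder_blockBits {s d n : ℕ} (hs : 1 ≤ s) (hn : s * (d + 1) ≤ n) :
    (SCCs (ladder (level n (s * (d + 1) - 1)) (blockBits d))).ncard = s := by
  have hpos : 0 < s * (d + 1) := by positivity
  have hm : s * (d + 1) - 1 < n := by omega
  let f : ℕ → Set (Fin n) := fun q => {v | level n (s * (d + 1) - 1) v / (d + 1) = q}
  have hex : ∀ q < s, ∃ u, level n (s * (d + 1) - 1) u / (d + 1) = q := fun q hq => by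
    have : (q + 1) * (d + 1) ≤ s * (d + 1) := Nat.mul_le_mul_right _ hq
    rw [add_mul] at this
    obtain ⟨u, hu⟩ := exists_level_eq (i := q * (d + 1)) hm (by omega)
    exact ⟨u, by rw [hu, Nat.mul_div_cancel _ (Nat.add_one_pos d)]⟩
  have himage : SCCs (ladder (level n (s * (d + 1) - 1)) (blockBits d)) = f '' Set.Iio s := by
    ext X
    constructor
    · rintro ⟨u, rfl⟩
      refine ⟨level n (s * (d + 1) - 1) u / (d + 1), ?_,
        (scc_ladder_blockBits (exists_level_eq_of_lt hm) d u).symm⟩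
      rw [Set.mem_Iio, Nat.div_lt_iff_lt_mul (Nat.add_one_pos d)]
      have : level n (s * (d + 1) - 1) u ≤ s * (d + 1) - 1 := min_le_right _ _
      omega
    · rintro ⟨q, hq, rfl⟩
      obtain ⟨u, hu⟩ := hex q hq
      exact ⟨u, by rw [scc_ladder_blockBits (exists_level_eq_of_lt hm), hu]⟩
  have hinj : Set.InjOn f (Set.Iio s) := by
    intro p hp q _ hpq
    obtain ⟨u, hu⟩ := hex p hp
    have : u ∈ f q := hpq ▸ hu
    exact hu.symm.trans this
  rw [himage, hinj.ncard_image, ← Finset.coe_range, Set.ncard_coe_finset,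
    Finset.card_range]

/-- Each of the `s` blocks of `d + 1` levels has `d` interior bits. -/
theorem exists_finset_blockBits (s d : ℕ) : ∃ J : Finset ℕ, J.card = s * d ∧
    ∀ j ∈ J, j + 1 < s * (d + 1) ∧ j ∈ blockBits d := by
  refine ⟨(Finset.range s ×ˢ Finset.range d).image fun p => (d + 1) * p.1 + p.2, ?_, ?_⟩
  · rw [Finset.card_image_of_injOn, Finset.card_product, Finset.card_range, Finset.card_range]
    rintro ⟨a, b⟩ hab ⟨a', b'⟩ hab' h
    simp only [Finset.coe_product, Finset.coe_range, Set.mem_prod, Set.mem_Iio] at hab hab' h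
    have hdiv := congrArg (· / (d + 1)) h
    simp only [Nat.mul_add_div (Nat.add_one_pos d), Nat.div_eq_of_lt (hab.2.trans (Nat.lt_succ_self d)),
      Nat.div_eq_of_lt (hab'.2.trans (Nat.lt_succ_self d)), add_zero] at hdiv
    subst hdiv
    simpa using h
  · intro j hj
    obtain ⟨⟨a, b⟩, hab, rfl⟩ := Finset.mem_image.1 hj
    simp only [Finset.mem_product, Finset.mem_range] at hab ⊢
    constructor
    · have := Nat.mul_le_mul_left (d + 1) (Nat.succ_le_of_lt hab.1)
      rw [Nat.succ_eq_add_one, mul_add, mul_comm _ s] at this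
      omega
    · intro h
      rw [add_assoc, Nat.dvd_add_right (Dvd.intro _ rfl)] at h
      have := Nat.le_of_dvd (Nat.succ_pos b) h
      omega

theorem exists_ncard_diam_eq_and_mul_le_expectedSteps {ε : ℝ} (hε : 0 ≤ ε)
    {s d n : ℕ} (hs : 1 ≤ s) (hd : 1 ≤ d) (hn : s * (d + 1) ≤ n) :
    ∃ G : Digraph (Fin n), (SCCs G).ncard = s ∧ diam G = d ∧
      ∀ R : RandAlgorithm (Fin n), ComputesSCCsWithError R ε (diamAtMost (Fin n) d) →
        ENNReal.ofReal ((1 - 2 * ε) * ((SCCs G).ncard * diam G)) ≤ expectedSteps R G := by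
  have hle : 1 * (d + 1) ≤ s * (d + 1) := Nat.mul_le_mul_right _ hs
  have hm : s * (d + 1) - 1 < n := by omega
  have hℓ := exists_level_eq_of_lt hm
  obtain ⟨u, hu⟩ := exists_level_eq hm (show d ≤ s * (d + 1) - 1 by omega)
  have hdiam : diam (ladder (level n (s * (d + 1) - 1)) (blockBits d)) = d :=
    diam_ladder_eq hℓ hd (exists_notMem_blockBits d)
      (fun i hi h => by have := Nat.le_of_dvd (Nat.succ_pos i) h; omega) hu
  refine ⟨_, ncard_SCCs_ladder_blockBits hs hn, hdiam, fun R hR => ?_⟩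
  obtain ⟨J, hcard, hJ⟩ := exists_finset_blockBits s d
  rw [ncard_SCCs_ladder_blockBits hs hn, hdiam, ← Nat.cast_mul, ← hcard]
  refine le_expectedSteps_ladder hε hR hdiam.le J fun j hj => ?_
  obtain ⟨hj₁, hj₂⟩ := hJ j hj
  obtain ⟨w, hw⟩ := exists_level_eq hm (show j + 1 ≤ s * (d + 1) - 1 by omega)
  refine ⟨diam_ladder_le hℓ hd fun a => ?_, SCCs_ladder_ne hℓ hw (not_mem_iff_mem_symmDiff_singleton _ j)⟩
  obtain ⟨i, hi, hi', hiB⟩ := exists_notMem_blockBits d a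
  refine ⟨i, hi, hi', ?_⟩
  rw [Set.mem_symmDiff]
  -- Bits of `J` are set, so a flip only clears a bit and never lengthens a run.
  rintro (⟨h, -⟩ | ⟨rfl, h⟩)
  · exact hiB h
  · exact h hj₂

end Instances

end SymbolicGraph

theorem theorem3p1 :
    -- deterministic algorithms, bound in terms of the number of vertices
    (∃ c : ℝ, 0 < c ∧ ∀ d n : ℕ, 1 ≤ d → d + 1 ≤ n →
      ∀ A : SymbolicGraph.Algorithm (Fin n),
        SymbolicGraph.ComputesSCCs A (SymbolicGraph.diamAtMost (Fin n) d) →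
        ∃ G : Digraph (Fin n), SymbolicGraph.diam G = d ∧ c * n ≤ A.steps G) ∧
    -- deterministic algorithms, bound in terms of the number of SCCs and the diameter
    (∃ c : ℝ, 0 < c ∧ ∀ s d n : ℕ, 1 ≤ s → 1 ≤ d → s * (d + 1) ≤ n →
      ∀ A : SymbolicGraph.Algorithm (Fin n),
        SymbolicGraph.ComputesSCCs A (SymbolicGraph.diamAtMost (Fin n) d) →
        ∃ G : Digraph (Fin n), (SymbolicGraph.SCCs G).ncard = s ∧ SymbolicGraph.diam G = d ∧
          c * ((SymbolicGraph.SCCs G).ncard * SymbolicGraph.diam G) ≤ A.steps G) ∧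
    -- randomized algorithms with error at most `ε`, bound in terms of the number of vertices
    (∀ ε : ℝ, 0 ≤ ε → ε < 1 / 2 → ∃ c : ℝ, 0 < c ∧ ∀ d n : ℕ, 1 ≤ d → d + 1 ≤ n →
      ∀ R : SymbolicGraph.RandAlgorithm (Fin n),
        SymbolicGraph.ComputesSCCsWithError R ε (SymbolicGraph.diamAtMost (Fin n) d) →
        ∃ G : Digraph (Fin n), SymbolicGraph.diam G = d ∧
          ENNReal.ofReal (c * n) ≤ SymbolicGraph.expectedSteps R G) ∧
    -- randomized algorithms, bound in terms of the number of SCCs and the diameter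
    (∀ ε : ℝ, 0 ≤ ε → ε < 1 / 2 → ∃ c : ℝ, 0 < c ∧ ∀ s d n : ℕ, 1 ≤ s → 1 ≤ d →
      s * (d + 1) ≤ n →
      ∀ R : SymbolicGraph.RandAlgorithm (Fin n),
        SymbolicGraph.ComputesSCCsWithError R ε (SymbolicGraph.diamAtMost (Fin n) d) →
        ∃ G : Digraph (Fin n), (SymbolicGraph.SCCs G).ncard = s ∧ SymbolicGraph.diam G = d ∧
          ENNReal.ofReal (c * ((SymbolicGraph.SCCs G).ncard * SymbolicGraph.diam G)) ≤
            SymbolicGraph.expectedSteps R G) := by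
  open SymbolicGraph in
  refine ⟨⟨(1 - 2 * 0) / 3, by norm_num, fun d n hd hn A hA => ?_⟩,
    ⟨1 - 2 * 0, by norm_num, fun s d n hs hd hn A hA => ?_⟩,
    fun ε hε hε' => ⟨(1 - 2 * ε) / 3, by linarith, fun d n hd hn R hR => ?_⟩,
    fun ε hε hε' => ⟨1 - 2 * ε, by linarith, fun s d n hs hd hn R hR => ?_⟩⟩
  · obtain ⟨G, hG, h⟩ := exists_diam_eq_and_card_le_expectedSteps le_rfl (by norm_num) hd hn
    exact ⟨G, hG, le_steps_of_ofReal_le_expectedSteps_pure (h _ (computesSCCsWithError_pure hA))⟩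
  · obtain ⟨G, hG, hG', h⟩ := exists_ncard_diam_eq_and_mul_le_expectedSteps le_rfl hs hd hn
    exact ⟨G, hG, hG',
      le_steps_of_ofReal_le_expectedSteps_pure (h _ (computesSCCsWithError_pure hA))⟩
  · obtain ⟨G, hG, h⟩ := exists_diam_eq_and_card_le_expectedSteps hε hε' hd hn
    exact ⟨G, hG, h R hR⟩
  · obtain ⟨G, hG, hG', h⟩ := exists_ncard_diam_eq_and_mul_le_expectedSteps hε hs hd hn
    exact ⟨G, hG, hG', h R hR⟩
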